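/- **Setting.** Let $\ell\ge 1$, let $\mathsf m=(m_1,\dots,m_\ell)$ be a tuple of positive integers, $n=m_1+\cdots+m_\ell$, and let $W_{\mathsf m}$ be the set of words $w=w_1\cdots w_n$ in the alphabet $\{1,\dots,\ell\}$ in which each letter $j$ occurs exactly $m_j$ times. Let $q\ge 1$ be a real number and let $\overline{\mathsf x}=(\overline x_1,\dots,\overline x_\ell)$ be positive real weights (in the probabilistic setting $\overline x_1+\cdots+\overline x_\ell=1$; this normalization is not needed). Write $[k]_q=1+q+\cdots+q^{k-1}$ and $[k]_q!=[1]_q\cdots[k]_q$. For $1\le i<n$ let $T_i$ act linearly from the right on the span of $W_{\mathsf m}$ by $$w\cdot T_i=\begin{cases} q\,(w_1\dots w_{i+1}w_i\dots w_n) & \text{if } w_{i+1}\le w_i,\\ (w_1\dots w_{i+1}w_i\dots w_n)+(q-1)\,w & \text{if } w_{i+1}>w_i,\end{cases}$$ and let $w\cdot\mathcal X=\dfrac{\overline x_{w_1}}{q^{m_{w_1+1}+\cdots+m_\ell}[m_{w_1}]_q}\,w$. The $q$-Tsetlin library on words is given by the right action of $\mathcal T=\sum_{i=1}^n T_{i-1}\cdots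 T_1\,\mathcal X$ (the term $i=1$ being $\mathcal X$). For a weakly decreasing tuple $\mathsf b=(b_1,\dots,b_k)$ of letters put $$\kappa(\mathsf b)=\sum_{i=1}^k \frac{q^{\,i+m_1+\cdots+m_{b_i}-k-1}}{[m_{b_i}]_q}\,\overline x_{b_i},$$ and for an arbitrary tuple let $\kappa(\mathsf b)$ be the value at its weakly decreasing rearrangement. For $w\in W_{\mathsf m}$ let $\mathrm{inv}(w)=\#\{(i,j): i<j,\ w_i>w_j\}$, and let $\mathrm{LRM}(w)$ be the set of positions $k$ such that $w_k\le w_i$ for all $i\le k$. For $k\notin\mathrm{LRM}(w)$ let $p_k$ be the smallest position $i<k$ with $w_i<w_k$. **Theorem.** 1. Up to scaling, there is exactly one nonzero row vector $\Psi$ indexed by $W_{\mathsf m}$ with $\Psi\cdot\mathcal T=\left(\sum_{i=1}^\ell\overline x_i\right)\Psi$. Its representative with entries summing to $1$ is $$\Psi_w=\frac{q^{-\mathrm{inv}(w)}\prod_{i=1}^\ell q^{-\binom{m_i}{2}}[m_i]_q!}{\prod_{k=1}^{n-1}\left(\overline x_1+\cdots+\overline x_\ell-q^{k-n-1}\kappa(w_1,\dots,w_{k-1})\right)}\prod_{\substack{1\le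 k\le n-1\\ k\in\mathrm{LRM}(w)}}\kappa(w_k)\prod_{\substack{1\le k\le n-1\\ k\notin\mathrm{LRM}(w)}}\left(\kappa(w_{p_k},\dots,w_k)-q^{-1}\kappa(w_{p_k},\dots,w_{k-1})\right).$$ 2. Each factor occurring in this formula, in the numerator and in the denominator, is positive. 3. The entries $\Psi_w$, $w\in W_{\mathsf m}$, sum to $1$. -/

import Mathlib

open Finset

namespace QTsetlin

/-- The `q`-integer `[k]_q = 1 + q + ⋯ + q^(k-1)`. -/
noncomputable def qInt (q : ℝ) (k : ℕ) : ℝ := ∑ i ∈ range k, q ^ i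

/-- The `q`-factorial `[k]_q! = [1]_q [2]_q ⋯ [k]_q`. -/
noncomputable def qFactorial (q : ℝ) (k : ℕ) : ℝ := ∏ i ∈ range k, qInt q (i + 1)

/-- Words `w` of length `n` in the alphabet `Fin ℓ` in which each letter `j` occurs exactly
`m j` times. Positions and letters are counted from `0`. -/
abbrev Word {ℓ : ℕ} (n : ℕ) (m : Fin ℓ → ℕ) : Type :=
  {w : Fin n → Fin ℓ // ∀ j, #{i | w i = j} = m j}

variable {ℓ n : ℕ} {m : Fin ℓ → ℕ}

/-- The word obtained from `w` by exchanging the letters in positions `i` and `i + 1`. -/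
def Word.swap (w : Word n m) (i : ℕ) (hi : i + 1 < n) : Word n m :=
  ⟨fun a => w.1 (Equiv.swap (⟨i, by omega⟩ : Fin n) ⟨i + 1, hi⟩ a), fun j => by
    rw [← w.2 j]
    exact Finset.card_equiv (Equiv.swap (⟨i, by omega⟩ : Fin n) ⟨i + 1, hi⟩) (by simp)⟩

/-- The right action of a Hecke generator on the span of the words, as a matrix: row `w` holds the
coefficients of `w · T`, where `T` acts on the positions `i` and `i + 1` (counted from `0`). -/
noncomputable def heckeT (q : ℝ) (i : ℕ) (hi : i + 1 < n) :
    Matrix (Word n m) (Word n m) ℝ :=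
  Matrix.of fun w v =>
    if w.1 ⟨i + 1, hi⟩ ≤ w.1 ⟨i, by omega⟩ then
      (if v = w.swap i hi then q else 0)
    else
      (if v = w.swap i hi then 1 else 0) + (if v = w then q - 1 else 0)

/-- The matrix of the right action of the product of Hecke generators that takes position `i`
(counted from `0`) to the front: first the generator on positions `i - 1, i`, then the one on
`i - 2, i - 1`, and so on down to the one on positions `0, 1`. -/
noncomputable def toFront (q : ℝ) : (i : ℕ) → i < n → Matrix (Word n m) (Word n m) ℝ
  | 0, _ => 1
  | i + 1, h => heckeT q i h * toFront q i (by omega)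

/-- The diagonal operator
`w ↦ x_{w_1} / (q^(m_{w_1 + 1} + ⋯ + m_ℓ) [m_{w_1}]_q) w`, with `w_1` the first letter of `w`. -/
noncomputable def weightX [NeZero n] (q : ℝ) (x : Fin ℓ → ℝ) :
    Matrix (Word n m) (Word n m) ℝ :=
  Matrix.diagonal fun w =>
    x (w.1 0) / (q ^ (∑ j ∈ Ioi (w.1 0), m j) * qInt q (m (w.1 0)))

/-- The transition matrix of the `q`-Tsetlin library on words of content `m`, acting on row
vectors from the right. -/
noncomputable def tsetlin [NeZero n] (q : ℝ) (x : Fin ℓ → ℝ) :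
    Matrix (Word n m) (Word n m) ℝ :=
  (∑ i : Fin n, toFront q i.1 i.2) * weightX q x

/-- The function `κ` on tuples of letters: the tuple is first sorted into weakly decreasing order
`b_1 ≥ ⋯ ≥ b_k`, and then `κ` is the sum over `i = 1, …, k` of
`q^(i + m_1 + ⋯ + m_{b_i} - k - 1) / [m_{b_i}]_q * x_{b_i}`.
In the code `i` is counted from `0`, so the exponent reads `i + (m_1 + ⋯ + m_{b_i}) - k`. -/
noncomputable def kappa (q : ℝ) (m : Fin ℓ → ℕ) (x : Fin ℓ → ℝ) (b : List (Fin ℓ)) : ℝ :=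
  let c := b.insertionSort (· ≥ ·)
  ∑ i : Fin c.length,
    q ^ ((i.1 : ℤ) + (∑ j ∈ Iic (c.get i), m j : ℕ) - (c.length : ℤ)) / qInt q (m (c.get i)) * x (c.get i)

/-- The list, in order, of the letters of `w` in the positions that satisfy `P`. -/
def subword (w : Word n m) (P : Fin n → Prop) [DecidablePred P] : List (Fin ℓ) :=
  ((List.finRange n).filter fun i => P i).map w.1

/-- Position `k` is a (weak) left-to-right minimum of `w`. -/
def IsLRM (w : Word n m) (k : Fin n) : Prop := ∀ i ≤ k, w.1 k ≤ w.1 i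

instance (w : Word n m) : DecidablePred (IsLRM w) := fun k => by unfold IsLRM; infer_instance

/-- If `k` is not a left-to-right minimum of `w`, the smallest position `i < k` with `w_i < w_k`
(and `k` itself otherwise, a value that is never used). -/
def firstBelow (w : Word n m) (k : Fin n) : Fin n :=
  if h : ({i | i < k ∧ w.1 i < w.1 k} : Finset (Fin n)).Nonempty then
    ({i | i < k ∧ w.1 i < w.1 k} : Finset (Fin n)).min' h
  else k

/-- The number of inversions of `w`. -/
def inv (w : Word n m) : ℕ := #{p : Fin n × Fin n | p.1 < p.2 ∧ w.1 p.1 > w.1 p.2}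

/-- The factor of the denominator with index `k`, that is,
`x_1 + ⋯ + x_ℓ - q^(k - n - 1) κ(w_1, …, w_{k-1})` if positions are counted from `1`. -/
noncomputable def denFactor (q : ℝ) (x : Fin ℓ → ℝ) (w : Word n m) (k : Fin n) : ℝ :=
  ∑ j, x j - q ^ ((k.1 : ℤ) - (n : ℤ)) * kappa q m x (subword w (· < k))

/-- The factor `κ(w_k)` of the numerator, for left-to-right minima. -/
noncomputable def lrmFactor (q : ℝ) (x : Fin ℓ → ℝ) (w : Word n m) (k : Fin n) : ℝ :=
  kappa q m x [w.1 k]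

/-- The factor `κ(w_{p_k}, …, w_k) - q⁻¹ κ(w_{p_k}, …, w_{k-1})` of the numerator, for positions
that are not left-to-right minima. -/
noncomputable def nonLrmFactor (q : ℝ) (x : Fin ℓ → ℝ) (w : Word n m) (k : Fin n) : ℝ :=
  kappa q m x (subword w fun i => firstBelow w k ≤ i ∧ i ≤ k) -
    q⁻¹ * kappa q m x (subword w fun i => firstBelow w k ≤ i ∧ i < k)

/-- The product formula. All products over positions leave out the last position. -/
noncomputable def Psi (q : ℝ) (x : Fin ℓ → ℝ) (w : Word n m) : ℝ :=
  ((q ^ inv w)⁻¹ * ∏ j, ((q ^ (m j).choose 2)⁻¹ * qFactorial q (m j))) /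
      (∏ k : Fin n with k.1 + 1 < n, denFactor q x w k) *
    ((∏ k : Fin n with k.1 + 1 < n ∧ IsLRM w k, lrmFactor q x w k) *
      ∏ k : Fin n with k.1 + 1 < n ∧ ¬ IsLRM w k, nonLrmFactor q x w k)

end QTsetlin

/-!
The product formula becomes transparent once `κ` is written in terms of contents. For a content
vector `c` (how often each letter occurs) put `K(c) = ∑_b a_b [c_b]_q q^(c_{b+1} + ⋯ + c_ℓ)`, where
`a_b = x_b q^(m_1 + ⋯ + m_b) / [m_b]_q`; this is `potential`. Then `κ` of a tuple of length `k` is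
`q^(-k) K(c)`, with `c` its content (`kappa_eq`), and `∑ x_j = q^(-n) K(m)`. If `c_k` denotes the
content of the first `k` letters of a word, the factor with index `k` (counted from `0`) in the
denominator is `q^(-n) (K(m) - K(c_k))`, and *both* kinds of factors in the numerator equal
`q^(-k-1) (K(c_{k+1}) - K(c_k))`: up to a power of `q`, the increment of `K` on adding the letter
`b` only depends on the letters below `b` (`increment_congr`), so for a left-to-right minimum the
earlier letters do not matter, and otherwise those in front of the first smaller letter do not.
Thus, as for the classical Tsetlin library, the formula is up to a constant
`q^(-inv w) ∏ (K(c_{k+1}) - K(c_k)) / (K(m) - K(c_k))` (`Psi_eq`).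

*Eigenvector.* Adding a letter `b' ≥ b` multiplies the increment for `b` by `q`
(`increment_addLetter`). Hence if `Q_j` is the formula with the quotient at position `j` left out,
`Q_{j+1} T_j + Ψ = Q_j`, a relation between two adjacent positions only (`localFactor_exchange`,
`vecMul_weightWithout_heckeT`). So `Ψ` applied to the sum of the products of Hecke generators
telescopes to `Q_0`, and the diagonal operator turns `Q_0` into a multiple of `Ψ`.

*Sum.* The increments satisfy `∑_b [d_b]_q q^(d_{b+1} + ⋯) (K(c + b) - K(c)) = K(m) - K(c)` with
`d = m - c` (`sum_qInt_mul_increment`). After normalization the formula is the law of a word whose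
letters are drawn one by one with the corresponding probabilities (`normalization_mul_weight`).

*Uniqueness.* The matrix is nonnegative and irreducible and `Ψ` is positive, so the maximum
argument of Perron applies (`eq_smul_of_vecMul_eq_smul`).
-/

namespace QTsetlin

variable {ℓ n : ℕ} {m : Fin ℓ → ℕ}

/-! ### `q`-integers and content vectors -/

lemma qInt_zero (q : ℝ) : qInt q 0 = 0 := by simp [qInt]

lemma qInt_succ (q : ℝ) (k : ℕ) : qInt q (k + 1) = qInt q k + q ^ k := by
  simp [qInt, sum_range_succ]

lemma sub_one_mul_qInt (q : ℝ) (k : ℕ) : (q - 1) * qInt q k = q ^ k - 1 := mul_geom_sum q k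

lemma qInt_add (q : ℝ) (a b : ℕ) : qInt q (a + b) = qInt q a + q ^ a * qInt q b := by
  simp [qInt, sum_range_add, mul_sum, pow_add]

lemma qInt_nonneg {q : ℝ} (hq : 0 < q) (k : ℕ) : 0 ≤ qInt q k :=
  sum_nonneg fun _ _ => by positivity

lemma qInt_pos {q : ℝ} (hq : 0 < q) {k : ℕ} (hk : 0 < k) : 0 < qInt q k :=
  sum_pos (fun _ _ => by positivity) (by simp; omega)

lemma qFactorial_pos {q : ℝ} (hq : 0 < q) (k : ℕ) : 0 < qFactorial q k :=
  prod_pos fun _ _ => qInt_pos hq (by omega)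

/-- The content vector `c` with one more letter `b`. -/
def addLetter (c : Fin ℓ → ℕ) (b : Fin ℓ) : Fin ℓ → ℕ := fun j => c j + if j = b then 1 else 0

@[simp] lemma addLetter_apply (c : Fin ℓ → ℕ) (b j : Fin ℓ) :
    addLetter c b j = c j + if j = b then 1 else 0 := rfl

lemma addLetter_comm (c : Fin ℓ → ℕ) (b b' : Fin ℓ) :
    addLetter (addLetter c b) b' = addLetter (addLetter c b') b := by
  ext j; simp only [addLetter_apply]; ring

lemma add_choose_two (a b : ℕ) : (a + b).choose 2 = a.choose 2 + b.choose 2 + a * b := by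
  induction b with
  | zero => simp
  | succ b ih =>
    rw [← add_assoc, Nat.choose_succ_succ' (a + b) 1, Nat.choose_succ_succ' b 1, ih]
    simp; ring

lemma sum_addLetter (s : Finset (Fin ℓ)) (c : Fin ℓ → ℕ) (b : Fin ℓ) :
    ∑ j ∈ s, (addLetter c b) j = ∑ j ∈ s, c j + if b ∈ s then 1 else 0 := by
  simp [addLetter, sum_add_distrib]

lemma sum_Iic_add_sum_Ioi (d : Fin ℓ → ℕ) (b : Fin ℓ) :
    ∑ j ∈ Iic b, d j + ∑ j ∈ Ioi b, d j = ∑ j, d j := by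
  rw [← sum_filter_add_sum_filter_not univ (· ≤ b)]
  congr 2 <;> (ext; simp)

/-! ### The potential of a content vector -/

/-- The potential of a content vector `c`. The function `κ` of a tuple is, up to a power of `q`,
the potential of its content, for the weights `a` of `letterWeight`. -/
noncomputable def potential (q : ℝ) (a : Fin ℓ → ℝ) (c : Fin ℓ → ℕ) : ℝ :=
  ∑ b, a b * qInt q (c b) * q ^ ∑ j ∈ Ioi b, c j

/-- The growth of the potential when one letter `b` is added to the content. -/
noncomputable def increment (q : ℝ) (a : Fin ℓ → ℝ) (c : Fin ℓ → ℕ) (b : Fin ℓ) : ℝ :=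
  potential q a (addLetter c b) - potential q a c

lemma potential_zero (q : ℝ) (a : Fin ℓ → ℝ) : potential q a 0 = 0 := by
  simp [potential, qInt_zero]

lemma increment_eq (q : ℝ) (a : Fin ℓ → ℝ) (c : Fin ℓ → ℕ) (b : Fin ℓ) :
    increment q a c b = a b * q ^ (∑ j ∈ Ici b, c j) +
      (q - 1) * ∑ j ∈ Iio b, a j * qInt q (c j) * q ^ ∑ i ∈ Ioi j, c i := by
  have h1 : a b * q ^ (∑ j ∈ Ici b, c j) =
      ∑ j, if j = b then a b * q ^ (∑ j ∈ Ici b, c j) else 0 := by simp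
  have h2 : ∑ j ∈ Iio b, a j * qInt q (c j) * q ^ (∑ i ∈ Ioi j, c i) =
      ∑ j, if j < b then a j * qInt q (c j) * q ^ (∑ i ∈ Ioi j, c i) else 0 := by
    rw [← sum_filter]; congr 1; ext; simp
  rw [increment, potential, potential, ← sum_sub_distrib, h1, h2, mul_sum, ← sum_add_distrib]
  refine sum_congr rfl fun j _ => ?_
  rw [sum_addLetter]
  rcases lt_trichotomy j b with h | rfl | h
  · simp [h, h.ne, pow_succ]; ring
  · have : ∑ i ∈ Ici j, c i = c j + ∑ i ∈ Ioi j, c i := by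
      rw [← Ioi_insert, sum_insert (by simp)]
    simp [qInt_succ, this, pow_add]; ring
  · simp [h.ne', h.not_gt]

lemma increment_zero (q : ℝ) (a : Fin ℓ → ℝ) (b : Fin ℓ) : increment q a 0 b = a b := by
  simp [increment_eq, qInt_zero]

lemma increment_pos {q : ℝ} (hq : 1 ≤ q) {a : Fin ℓ → ℝ} (ha : ∀ j, 0 < a j) (c : Fin ℓ → ℕ)
    (b : Fin ℓ) : 0 < increment q a c b := by
  have hq0 : 0 < q := by linarith
  rw [increment_eq]
  have h : 0 ≤ ∑ j ∈ Iio b, a j * qInt q (c j) * q ^ ∑ i ∈ Ioi j, c i :=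
    sum_nonneg fun j _ => mul_nonneg (mul_nonneg (ha j).le (qInt_nonneg hq0 _)) (by positivity)
  have := mul_nonneg (sub_nonneg.2 hq) h
  have := ha b
  positivity

/-- Adding first a letter that is at least `b` multiplies the increment for `b` by `q`. This
relation is what makes the product formula compatible with the Hecke generators. -/
lemma increment_addLetter (q : ℝ) (a : Fin ℓ → ℝ) (c : Fin ℓ → ℕ) {b b' : Fin ℓ} (h : b ≤ b') :
    increment q a (addLetter c b') b = q * increment q a c b := by
  have h1 : ∀ j ∈ Iio b, a j * qInt q ((addLetter c b') j) *
      q ^ (∑ i ∈ Ioi j, (addLetter c b') i) =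
      q * (a j * qInt q (c j) * q ^ ∑ i ∈ Ioi j, c i) := fun j hj => by
    have hj' : j < b' := (mem_Iio.1 hj).trans_le h
    rw [sum_addLetter]
    simp [hj', hj'.ne, pow_succ]; ring
  rw [increment_eq, increment_eq, sum_congr rfl h1, sum_addLetter, ← mul_sum]
  simp [h, pow_succ]; ring

lemma increment_add_increment (q : ℝ) (a : Fin ℓ → ℝ) (c : Fin ℓ → ℕ) (b b' : Fin ℓ) :
    increment q a c b + increment q a (addLetter c b) b' =
      increment q a c b' + increment q a (addLetter c b') b := by
  simp only [increment, addLetter_comm c b b']; ring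

/-- After division by the power of `q` that belongs to the length, the increment for `b` depends
only on the letters below `b`. -/
lemma increment_congr {q : ℝ} (hq : 0 < q) (a : Fin ℓ → ℝ) {c c' : Fin ℓ → ℕ} {b : Fin ℓ}
    (h : ∀ j < b, c j = c' j) :
    (q ^ (∑ j, c j + 1))⁻¹ * increment q a c b = (q ^ (∑ j, c' j + 1))⁻¹ * increment q a c' b := by
  have key : ∀ d : Fin ℓ → ℕ, (q ^ (∑ j, d j + 1))⁻¹ * increment q a d b =
      a b * (q ^ (∑ j ∈ Iio b, d j + 1))⁻¹ +
        (q - 1) * ∑ j ∈ Iio b, a j * qInt q (d j) * (q ^ (∑ i ∈ Iic j, d i + 1))⁻¹ := fun d => by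
    have e1 : ∑ j, d j = ∑ j ∈ Iio b, d j + ∑ j ∈ Ici b, d j := by
      rw [← sum_filter_add_sum_filter_not univ (· < b)]
      congr 2 <;> (ext; simp)
    rw [increment_eq, mul_add, mul_left_comm _ (q - 1), mul_sum, ← mul_assoc, mul_comm _ (a b),
      mul_assoc]
    congr 2
    · rw [e1, add_right_comm, pow_add]; field_simp
    · refine sum_congr rfl fun j _ => ?_
      rw [← sum_Iic_add_sum_Ioi d j, add_right_comm, pow_add]; field_simp
  rw [key, key, sum_congr rfl fun j hj => h j (mem_Iio.1 hj)]
  congr 2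
  refine sum_congr rfl fun j hj => ?_
  have hj := mem_Iio.1 hj
  rw [h j hj, sum_congr rfl fun i hi => h i ((mem_Iic.1 hi).trans_lt hj)]

lemma potential_addLetter_of_max (q : ℝ) (a : Fin ℓ → ℝ) {c : Fin ℓ → ℕ} {b : Fin ℓ}
    (h : ∀ j, b < j → c j = 0) :
    potential q a (addLetter c b) = q * potential q a c + a b := by
  have h0 : ∑ j ∈ Ioi b, c j = 0 := sum_eq_zero fun j hj => h j (mem_Ioi.1 hj)
  have h1 : ∑ j ∈ Ici b, c j = c b := by rw [← Ioi_insert, sum_insert (by simp), h0, add_zero]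
  have h2 : potential q a c = a b * qInt q (c b) +
      ∑ j ∈ Iio b, a j * qInt q (c j) * q ^ ∑ i ∈ Ioi j, c i := by
    rw [potential, ← sum_subset (subset_univ (Iic b)), ← Iio_insert, sum_insert (by simp), h0]
    · simp
    · intro j _ hj
      rw [h j (by simpa using hj), qInt_zero]; simp
  have := increment_eq q a c b
  rw [increment, h1] at this
  linear_combination this - (q - 1) * h2 - a b * sub_one_mul_qInt q (c b)

lemma sum_insert_min {M : Type*} [AddCommMonoid M] (f : Fin ℓ → ℕ → M) (d : Fin ℓ → ℕ)
    {s : Finset (Fin ℓ)} {b : Fin ℓ} (hb : ∀ j ∈ s, b < j) :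
    ∑ j ∈ insert b s, f j (∑ i ∈ insert b s with j < i, d i) =
      f b (∑ i ∈ s, d i) + ∑ j ∈ s, f j (∑ i ∈ s with j < i, d i) := by
  have hbs : b ∉ s := fun h => lt_irrefl _ (hb b h)
  rw [sum_insert hbs, filter_insert, if_neg (lt_irrefl b), filter_true_of_mem hb]
  congr 1
  refine sum_congr rfl fun j hj => ?_
  rw [filter_insert, if_neg (hb j hj).not_gt]

lemma sub_one_mul_sum_qInt (q : ℝ) (d : Fin ℓ → ℕ) (s : Finset (Fin ℓ)) :
    (q - 1) * ∑ b ∈ s, qInt q (d b) * q ^ (∑ i ∈ s with b < i, d i) = q ^ (∑ i ∈ s, d i) - 1 := by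
  induction s using Finset.induction_on_min with
  | empty => simp
  | insert b s hb ih =>
    rw [sum_insert_min (fun j e => qInt q (d j) * q ^ e) d hb,
      sum_insert fun h => lt_irrefl _ (hb b h), mul_add, ih,
      ← mul_assoc, sub_one_mul_qInt, pow_add]
    ring

/-- The sum rule that makes the product formula a probability distribution: if the next letter
`b` is weighted by `[d_b] q ^ (d_{b+1} + ⋯)`, with `d` the remaining content, then the increments
add up to the remaining potential. -/
lemma sum_qInt_mul_increment (q : ℝ) (a : Fin ℓ → ℝ) (c d : Fin ℓ → ℕ) :
    ∑ b, qInt q (d b) * q ^ (∑ j ∈ Ioi b, d j) * increment q a c b =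
      potential q a (c + d) - potential q a c := by
  set t : Fin ℓ → ℝ := fun j => a j * qInt q (c j) * q ^ ∑ i ∈ Ioi j, c i with ht
  set g : Fin ℓ → ℝ := fun b => qInt q (d b) * q ^ (∑ j ∈ Ioi b, d j) with hg
  have hswap : ∑ b, g b * ∑ j ∈ Iio b, t j = ∑ j, t j * ∑ b ∈ Ioi j, g b := by
    simp only [mul_sum]
    rw [sum_comm' (t' := univ) (s' := fun j => Ioi j) (by simp)]
    exact sum_congr rfl fun j _ => sum_congr rfl fun b _ => mul_comm _ _
  have htail : ∀ j, (q - 1) * ∑ b ∈ Ioi j, g b = q ^ (∑ i ∈ Ioi j, d i) - 1 := fun j => by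
    rw [← sub_one_mul_sum_qInt]
    congr 1
    refine sum_congr rfl fun b hb => ?_
    have : ({i ∈ Ioi j | b < i} : Finset (Fin ℓ)) = Ioi b := by
      ext i
      simp only [mem_filter, mem_Ioi] at hb ⊢
      exact ⟨fun h => h.2, fun h => ⟨hb.trans h, h⟩⟩
    rw [this]
  have h1 : ∑ b, g b * increment q a c b = ∑ b, g b * (a b * q ^ (∑ j ∈ Ici b, c j)) +
      ∑ j, t j * (q ^ (∑ i ∈ Ioi j, d i) - 1) := by
    simp only [increment_eq, mul_add, sum_add_distrib]
    congr 1
    simp only [← htail, mul_left_comm _ (q - 1), ← mul_sum]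
    rw [← hswap]
  rw [h1, potential, potential, ← sum_add_distrib, ← sum_sub_distrib]
  refine sum_congr rfl fun j _ => ?_
  have e : ∑ i ∈ Ici j, c i = c j + ∑ i ∈ Ioi j, c i := by
    rw [← Ioi_insert, sum_insert (by simp)]
  simp only [hg, ht, Pi.add_apply, qInt_add, sum_add_distrib, pow_add, e]
  ring

lemma potential_lt {q : ℝ} (hq : 1 ≤ q) {a : Fin ℓ → ℝ} (ha : ∀ j, 0 < a j) {c m : Fin ℓ → ℕ}
    (h : c < m) : potential q a c < potential q a m := by
  have hq0 : 0 < q := by linarith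
  obtain ⟨hle, j, hj⟩ := Pi.lt_def.1 h
  rw [← sub_pos, ← add_tsub_cancel_of_le hle, ← sum_qInt_mul_increment]
  refine sum_pos' (fun b _ => ?_) ⟨j, mem_univ _, ?_⟩
  · exact mul_nonneg (mul_nonneg (qInt_nonneg hq0 _) (by positivity)) (increment_pos hq ha c b).le
  · have h1 : 0 < qInt q ((m - c) j) := qInt_pos hq0 (by simpa using hj)
    have := increment_pos hq ha c j
    positivity

/-! ### An identity for binomial coefficients -/

lemma sum_mul_sum_add_sum_choose_two (m : Fin ℓ → ℕ) (s : Finset (Fin ℓ)) :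
    ∑ b ∈ s, m b * (∑ i ∈ s with b < i, m i) + ∑ b ∈ s, (m b).choose 2 =
      (∑ b ∈ s, m b).choose 2 := by
  induction s using Finset.induction_on_min with
  | empty => simp
  | insert b s hb ih =>
    have hbs : b ∉ s := fun h => lt_irrefl _ (hb b h)
    rw [sum_insert_min (fun j e => m j * e) m hb, sum_insert hbs, sum_insert hbs, add_choose_two,
      ← ih]
    ring

/-! ### Contents of prefixes -/

/-- The content of the first `k` letters of `w`: how often each letter occurs among them. -/
def content {N : ℕ} (w : Fin N → Fin ℓ) (k : ℕ) : Fin ℓ → ℕ := fun j => #{i | i.1 < k ∧ w i = j}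

lemma content_zero {N : ℕ} (w : Fin N → Fin ℓ) : content w 0 = 0 := by
  ext j; simp [content]

lemma content_succ {N : ℕ} (w : Fin N → Fin ℓ) {k : ℕ} (hk : k < N) :
    content w (k + 1) = addLetter (content w k) (w ⟨k, hk⟩) := by
  ext j
  have h : ∀ i : Fin N, i.1 < k + 1 ↔ i.1 < k ∨ i = ⟨k, hk⟩ := fun i => by
    rw [Fin.ext_iff]; exact Nat.lt_succ_iff_lt_or_eq
  simp only [content, addLetter_apply, h, or_and_right, filter_or]
  rw [card_union_of_disjoint]
  · congr 1
    split_ifs with hj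
    · rw [card_eq_one]
      refine ⟨⟨k, hk⟩, ?_⟩
      ext i
      simp only [mem_filter, mem_univ, true_and, mem_singleton]
      exact ⟨fun h => h.1, fun h => ⟨h, h ▸ hj.symm⟩⟩
    · rw [card_eq_zero, filter_eq_empty_iff]
      rintro i - ⟨rfl, h⟩
      exact hj h.symm
  · rw [disjoint_filter]
    rintro i - ⟨h, -⟩ ⟨rfl, -⟩
    exact lt_irrefl _ h

lemma sum_content {N : ℕ} (w : Fin N → Fin ℓ) {k : ℕ} (hk : k ≤ N) : ∑ j, content w k j = k := by
  induction k with
  | zero => simp [content_zero]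
  | succ k ih => rw [content_succ w hk, sum_addLetter, ih (by omega)]; simp

lemma content_self (w : Word n m) : content w.1 n = m := by
  ext j; rw [← w.2 j]; simp [content]

lemma content_lt (w : Word n m) {k : ℕ} (hk : k < n) : content w.1 k < m := by
  refine lt_of_le_of_ne (fun j => ?_) fun h => ?_
  · rw [← w.2 j]
    exact card_le_card fun i => by simp
  · have h1 := sum_content w.1 hk.le
    have h2 := sum_content w.1 le_rfl
    rw [h, ← content_self w, h2] at h1
    omega

lemma count_subword (w : Word n m) (P : Fin n → Prop) [DecidablePred P] (j : Fin ℓ) :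
    (subword w P).count j = #{i | P i ∧ w.1 i = j} := by
  have : #{i | P i ∧ w.1 i = j} = (List.finRange n).countP fun i => P i ∧ w.1 i = j := by
    rw [List.countP_eq_length_filter]; rfl
  rw [this, subword, List.count, List.countP_map, List.countP_filter]
  congr 1
  ext i
  rw [Function.comp_apply, Bool.and_comm, beq_eq_decide, Bool.decide_and]

lemma sum_count (l : List (Fin ℓ)) : ∑ j, l.count j = l.length := by
  simpa using (Multiset.sum_count_eq_card (s := univ) (m := (l : Multiset (Fin ℓ))) (by simp))

/-! ### The function `κ` and the factors of the product formula as potentials -/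

/-- The weights `x_b q ^ (m_1 + ⋯ + m_b) / [m_b]_q` for which `κ` becomes a potential. -/
noncomputable def letterWeight (q : ℝ) (m : Fin ℓ → ℕ) (x : Fin ℓ → ℝ) (b : Fin ℓ) : ℝ :=
  x b * q ^ (∑ j ∈ Iic b, m j) / qInt q (m b)

lemma letterWeight_pos {q : ℝ} (hq : 0 < q) (hm : ∀ j, 0 < m j) {x : Fin ℓ → ℝ}
    (hx : ∀ j, 0 < x j) (b : Fin ℓ) : 0 < letterWeight q m x b := by
  have := hx b
  have := qInt_pos hq (hm b)
  rw [letterWeight]; positivity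

lemma sum_eq_potential_of_sorted {q : ℝ} (hq : 0 < q) (m : Fin ℓ → ℕ) (x : Fin ℓ → ℝ)
    (c : List (Fin ℓ)) (hc : c.Pairwise (· ≥ ·)) :
    ∑ i : Fin c.length, q ^ ((i.1 : ℤ) + (∑ j ∈ Iic (c.get i), m j : ℕ) - (c.length : ℤ)) /
        qInt q (m (c.get i)) * x (c.get i) =
      (q ^ c.length)⁻¹ * potential q (letterWeight q m x) fun j => c.count j := by
  induction c with
  | nil => simp [potential, qInt_zero]
  | cons b c ih =>
    rw [List.pairwise_cons] at hc
    have h1 : (fun j => (b :: c).count j) = addLetter (fun j => c.count j) b := by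
      ext j; rw [List.count_cons, addLetter_apply]; simp only [beq_iff_eq, @eq_comm _ b j]
    have h2 : ∀ j, b < j → c.count j = 0 := fun j hj =>
      List.count_eq_zero.2 fun h => (hc.1 j h).not_gt hj
    rw [h1, potential_addLetter_of_max q _ h2]
    refine (Fin.sum_univ_succ _).trans ?_
    have h3 : ∀ i : Fin c.length,
        q ^ (((i.succ : Fin (c.length + 1)).1 : ℤ) + (∑ j ∈ Iic (c.get i), m j : ℕ) -
          ((b :: c).length : ℤ)) =
        q ^ ((i.1 : ℤ) + (∑ j ∈ Iic (c.get i), m j : ℕ) - (c.length : ℤ)) := fun i => by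
      congr 1; simp; ring
    have h4 : q ^ ((((0 : Fin (c.length + 1)).1 : ℕ) : ℤ) + (∑ j ∈ Iic b, m j : ℕ) -
        ((b :: c).length : ℤ)) = q ^ (∑ j ∈ Iic b, m j) * (q ^ (c.length + 1))⁻¹ := by
      rw [zpow_sub₀ hq.ne']
      simp only [Fin.val_zero, Nat.cast_zero, zero_add, zpow_natCast, List.length_cons]
      rfl
    have h5 := ih hc.2
    simp only [← h3] at h5
    refine (congrArg₂ (· + ·) (congrArg (fun t => t / qInt q (m b) * x b) h4) h5).trans ?_
    simp only [letterWeight, List.length_cons, pow_succ]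
    field_simp
    ring

lemma kappa_eq {q : ℝ} (hq : 0 < q) (m : Fin ℓ → ℕ) (x : Fin ℓ → ℝ) (l : List (Fin ℓ)) :
    kappa q m x l =
      (q ^ l.length)⁻¹ * potential q (letterWeight q m x) fun j => l.count j := by
  have h := sum_eq_potential_of_sorted hq m x (l.insertionSort (· ≥ ·))
    (List.pairwise_insertionSort _ _)
  refine h.trans ?_
  rw [List.length_insertionSort]
  congr 2
  ext j
  exact (List.perm_insertionSort _ l).count_eq j

lemma sum_eq_potential {q : ℝ} (hq : 0 < q) (hm : ∀ j, 0 < m j) (hn : ∑ j, m j = n)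
    (x : Fin ℓ → ℝ) : ∑ j, x j = (q ^ n)⁻¹ * potential q (letterWeight q m x) m := by
  rw [potential, mul_sum]
  refine sum_congr rfl fun b _ => ?_
  have h1 := (qInt_pos hq (hm b)).ne'
  rw [letterWeight, ← hn, ← sum_Iic_add_sum_Ioi m b, pow_add]
  field_simp

lemma denFactor_eq {q : ℝ} (hq : 0 < q) (hm : ∀ j, 0 < m j) (hn : ∑ j, m j = n)
    (x : Fin ℓ → ℝ) (w : Word n m) (k : Fin n) :
    denFactor q x w k = (q ^ n)⁻¹ * (potential q (letterWeight q m x) m -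
      potential q (letterWeight q m x) (content w.1 k)) := by
  have h1 : (fun j => (subword w (· < k)).count j) = content w.1 k := by
    ext j; rw [count_subword]; rfl
  have h2 : (subword w (· < k)).length = k := by
    rw [← sum_count, ← sum_content w.1 k.2.le, ← h1]
  rw [denFactor, kappa_eq hq, h1, h2, sum_eq_potential hq hm hn, zpow_sub₀ hq.ne']
  simp only [zpow_natCast]
  field_simp

lemma lrmFactor_eq {q : ℝ} (hq : 0 < q) (x : Fin ℓ → ℝ) (w : Word n m) (k : Fin n)
    (hk : IsLRM w k) :
    lrmFactor q x w k =
      (q ^ (k.1 + 1))⁻¹ * increment q (letterWeight q m x) (content w.1 k) (w.1 k) := by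
  have h1 : (fun j => [w.1 k].count j) = addLetter 0 (w.1 k) := by
    ext j; rw [List.count_cons, addLetter_apply]; simp [@eq_comm _ (w.1 k) j]
  have h2 := increment_congr hq (letterWeight q m x) (c := 0) (c' := content w.1 k) (b := w.1 k)
    fun j hj => by
      refine (card_eq_zero.2 (filter_eq_empty_iff.2 ?_)).symm
      rintro i - ⟨hi, rfl⟩
      exact (hk i hi.le).not_gt hj
  rw [sum_content w.1 k.2.le] at h2
  rw [lrmFactor, kappa_eq hq, h1, ← h2, increment, potential_zero]
  simp

lemma firstBelow_le (w : Word n m) (k : Fin n) : firstBelow w k ≤ k := by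
  rw [firstBelow]
  split_ifs with h
  · have := min'_mem _ h
    simp only [mem_filter] at this
    exact this.2.1.le
  · exact le_rfl

lemma firstBelow_le_of_lt (w : Word n m) {i k : Fin n} (hi : i < k) (h : w.1 i < w.1 k) :
    firstBelow w k ≤ i := by
  have hmem : i ∈ ({i | i < k ∧ w.1 i < w.1 k} : Finset (Fin n)) := by simp [hi, h]
  rw [firstBelow, dif_pos ⟨i, hmem⟩]
  exact min'_le _ _ hmem

/-- The window from `firstBelow w k` to `k` contains all earlier letters below `w_k`, so it may be
replaced by the whole prefix; the factor then has the same form as for left-to-right minima. -/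
lemma nonLrmFactor_eq {q : ℝ} (hq : 0 < q) (x : Fin ℓ → ℝ) (w : Word n m) (k : Fin n) :
    nonLrmFactor q x w k =
      (q ^ (k.1 + 1))⁻¹ * increment q (letterWeight q m x) (content w.1 k) (w.1 k) := by
  set l := subword w fun i => firstBelow w k ≤ i ∧ i < k with hl
  set l' := subword w fun i => firstBelow w k ≤ i ∧ i ≤ k with hl'
  set c : Fin ℓ → ℕ := fun j => l.count j with hc
  have h1 : (fun j => l'.count j) = addLetter c (w.1 k) := by
    ext j
    have e : ∀ i : Fin n, ((firstBelow w k ≤ i ∧ i ≤ k) ∧ w.1 i = j) ↔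
        (((firstBelow w k ≤ i ∧ i < k) ∧ w.1 i = j) ∨ (i = k ∧ w.1 k = j)) := fun i => by
      constructor
      · rintro ⟨⟨h, h'⟩, h''⟩
        rcases h'.lt_or_eq with h' | rfl
        · exact .inl ⟨⟨h, h'⟩, h''⟩
        · exact .inr ⟨rfl, h''⟩
      · rintro (⟨⟨h, h'⟩, h''⟩ | ⟨rfl, h⟩)
        · exact ⟨⟨h, h'.le⟩, h''⟩
        · exact ⟨⟨firstBelow_le w _, le_rfl⟩, h⟩
    have e' : #{i | i = k ∧ w.1 k = j} = if j = w.1 k then 1 else 0 := by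
      split_ifs with h
      · simp [h, filter_eq']
      · simp [Ne.symm h]
    simp only [hc, addLetter_apply, hl, hl', count_subword]
    rw [filter_congr fun i _ => e i, filter_or, card_union_of_disjoint, e']
    rw [disjoint_filter]
    rintro i - ⟨⟨-, h⟩, -⟩ ⟨rfl, -⟩
    exact lt_irrefl _ h
  have h2 : ∑ j, c j = l.length := sum_count l
  have h3 : l'.length = ∑ j, c j + 1 := by
    rw [← sum_count, h1, sum_addLetter]; simp
  have h4 := increment_congr hq (letterWeight q m x) (c := c) (c' := content w.1 k) (b := w.1 k)
    fun j hj => by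
      simp only [hc, hl, count_subword, content]
      congr 1
      refine filter_congr fun i _ => ?_
      constructor
      · rintro ⟨⟨-, h⟩, h'⟩
        exact ⟨h, h'⟩
      · rintro ⟨h, rfl⟩
        exact ⟨⟨firstBelow_le_of_lt w h hj, h⟩, rfl⟩
  rw [sum_content w.1 k.2.le] at h4
  rw [nonLrmFactor, kappa_eq hq, kappa_eq hq, ← hl, ← hl', h1, h3, ← h4, ← h2, increment, pow_succ,
    mul_inv]
  ring

/-! ### The product formula as a product of local factors -/

lemma inv_eq_sum (w : Word n m) : inv w = ∑ k : Fin n, ∑ j ∈ Ioi (w.1 k), content w.1 k j := by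
  have h : ∀ k : Fin n, ∑ j ∈ Ioi (w.1 k), content w.1 k j = #{i | i < k ∧ w.1 i > w.1 k} :=
    fun k => by
      rw [card_eq_sum_card_fiberwise (f := w.1) (t := Ioi (w.1 k)) fun i => by simp]
      refine sum_congr rfl fun j hj => ?_
      rw [filter_filter, content]
      congr 1
      refine filter_congr fun i _ => ?_
      rw [mem_Ioi] at hj
      constructor
      · rintro ⟨h, rfl⟩
        exact ⟨⟨h, hj⟩, rfl⟩
      · rintro ⟨⟨h, -⟩, h'⟩
        exact ⟨h, h'⟩
  simp only [h, inv, card_filter]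
  rw [Fintype.sum_prod_type_right]

/-- The contribution of one position to the product formula: `b` is the letter in that position
and `c` the content of the letters before it. -/
noncomputable def localFactor (q : ℝ) (a : Fin ℓ → ℝ) (m c : Fin ℓ → ℕ) (b : Fin ℓ) : ℝ :=
  (q ^ ∑ j ∈ Ioi b, c j)⁻¹ * (increment q a c b / (potential q a m - potential q a c))

/-- The normalizing constant of the product formula. -/
noncomputable def normalization (q : ℝ) (n : ℕ) (m : Fin ℓ → ℕ) : ℝ :=
  (∏ j, ((q ^ (m j).choose 2)⁻¹ * qFactorial q (m j))) * q ^ n.choose 2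

lemma Psi_eq {q : ℝ} (hq : 1 ≤ q) (hm : ∀ j, 0 < m j) (hn : ∑ j, m j = n)
    {x : Fin ℓ → ℝ} (hx : ∀ j, 0 < x j) (w : Word n m) :
    Psi q x w = normalization q n m *
      ∏ k : Fin n, localFactor q (letterWeight q m x) m (content w.1 k) (w.1 k) := by
  have hq0 : 0 < q := by linarith
  set a := letterWeight q m x with ha
  set f : Fin n → ℝ := fun k =>
    increment q a (content w.1 k) (w.1 k) / (potential q a m - potential q a (content w.1 k))
    with hf
  have hpos : ∀ k : Fin n, 0 < potential q a m - potential q a (content w.1 k) := fun k =>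
    sub_pos.2 (potential_lt hq (letterWeight_pos hq0 hm hx) (content_lt w k.2))
  have hnum : (∏ k : Fin n with k.1 + 1 < n ∧ IsLRM w k, lrmFactor q x w k) *
      ∏ k : Fin n with k.1 + 1 < n ∧ ¬ IsLRM w k, nonLrmFactor q x w k =
      ∏ k : Fin n with k.1 + 1 < n, (q ^ (k.1 + 1))⁻¹ * increment q a (content w.1 k) (w.1 k) := by
    rw [← prod_filter_mul_prod_filter_not (filter (fun k : Fin n => k.1 + 1 < n) univ)
      (fun k => IsLRM w k), filter_filter, filter_filter]
    congr 1 <;> refine prod_congr rfl fun k hk => ?_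
    · exact lrmFactor_eq hq0 x w k (mem_filter.1 hk).2.2
    · exact nonLrmFactor_eq hq0 x w k
  have hden : ∏ k : Fin n with k.1 + 1 < n, denFactor q x w k =
      ∏ k : Fin n with k.1 + 1 < n,
        (q ^ n)⁻¹ * (potential q a m - potential q a (content w.1 k)) :=
    prod_congr rfl fun k _ => denFactor_eq hq0 hm hn x w k
  -- the last position contributes the factor one
  have hfrac : (∏ k : Fin n with k.1 + 1 < n,
        (q ^ (k.1 + 1))⁻¹ * increment q a (content w.1 k) (w.1 k)) /
      (∏ k : Fin n with k.1 + 1 < n,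
        (q ^ n)⁻¹ * (potential q a m - potential q a (content w.1 k))) =
      ∏ k : Fin n, q ^ (n - 1 - k.1) * f k := by
    rw [← prod_div_distrib, prod_filter]
    refine prod_congr rfl fun k _ => ?_
    have := (hpos k).ne'
    split_ifs with hk
    · have e : q ^ n = q ^ (n - 1 - k.1) * q ^ (k.1 + 1) := by rw [← pow_add]; congr 1; omega
      rw [hf, e]; field_simp
    · have e : k.1 + 1 = n := by omega
      have e' : n - 1 - k.1 = 0 := by omega
      have e'' : increment q a (content w.1 k) (w.1 k) =
          potential q a m - potential q a (content w.1 k) := by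
        rw [increment, ← content_succ w.1 k.2, e, content_self]
      simp only [hf, e', e'', pow_zero, one_mul, div_self this]
  have hpow : ∏ k : Fin n, q ^ (n - 1 - k.1) = q ^ n.choose 2 := by
    rw [prod_pow_eq_pow_sum, Fin.sum_univ_eq_sum_range (fun k => n - 1 - k),
      sum_range_reflect (fun k => k), sum_range_id, Nat.choose_two_right]
  have hinv : (q ^ inv w)⁻¹ = ∏ k : Fin n, (q ^ ∑ j ∈ Ioi (w.1 k), content w.1 k j)⁻¹ := by
    rw [prod_inv_distrib, prod_pow_eq_pow_sum, inv_eq_sum]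
  rw [Psi, hnum, hden, div_mul_eq_mul_div, mul_div_assoc, hfrac,
    prod_mul_distrib (s := (univ : Finset (Fin n))), hpow, hinv,
    normalization]
  simp only [localFactor, prod_mul_distrib (s := (univ : Finset (Fin n))), hf]
  ring

/-! ### The action of the Hecke generators -/

lemma Word.swap_apply_left (w : Word n m) (i : ℕ) (hi : i + 1 < n) :
    (w.swap i hi).1 ⟨i, by omega⟩ = w.1 ⟨i + 1, hi⟩ := by
  simp [Word.swap]

lemma Word.swap_apply_right (w : Word n m) (i : ℕ) (hi : i + 1 < n) :
    (w.swap i hi).1 ⟨i + 1, hi⟩ = w.1 ⟨i, by omega⟩ := by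
  simp [Word.swap]

lemma Word.swap_apply_of_ne (w : Word n m) {i : ℕ} (hi : i + 1 < n) {k : Fin n} (h : k.1 ≠ i)
    (h' : k.1 ≠ i + 1) : (w.swap i hi).1 k = w.1 k := by
  simp only [Word.swap]
  rw [Equiv.swap_apply_of_ne_of_ne] <;> rwa [Ne, Fin.ext_iff]

lemma Word.swap_swap (w : Word n m) (i : ℕ) (hi : i + 1 < n) :
    (w.swap i hi).swap i hi = w := by
  apply Subtype.ext; funext k; simp [Word.swap]

lemma Word.eq_swap_iff (w v : Word n m) (i : ℕ) (hi : i + 1 < n) :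
    v = w.swap i hi ↔ w = v.swap i hi := by
  constructor <;> (rintro rfl; rw [Word.swap_swap])

lemma content_swap (w : Word n m) {i : ℕ} (hi : i + 1 < n) {k : ℕ} (hk : k ≠ i + 1) :
    content (w.swap i hi).1 k = content w.1 k := by
  ext j
  refine card_equiv (Equiv.swap (⟨i, by omega⟩ : Fin n) ⟨i + 1, hi⟩) fun p => ?_
  have h : ((Equiv.swap (⟨i, by omega⟩ : Fin n) ⟨i + 1, hi⟩) p).1 < k ↔ p.1 < k := by
    rw [Equiv.swap_apply_def]
    split_ifs with h1 h2
    · subst h1; simp; omega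
    · subst h2; simp; omega
    · rfl
  simp only [mem_filter, mem_univ, true_and, h]
  rfl

lemma vecMul_heckeT (q : ℝ) (f : Word n m → ℝ) (i : ℕ) (hi : i + 1 < n) (u : Word n m) :
    Matrix.vecMul f (heckeT q i hi) u =
      f (u.swap i hi) * (if u.1 ⟨i, by omega⟩ ≤ u.1 ⟨i + 1, hi⟩ then q else 1) +
        f u * if u.1 ⟨i + 1, hi⟩ ≤ u.1 ⟨i, by omega⟩ then 0 else q - 1 := by
  have h : ∀ w : Word n m, f w * heckeT q i hi w u =
      (if w = u.swap i hi then
        f w * (if w.1 ⟨i + 1, hi⟩ ≤ w.1 ⟨i, by omega⟩ then q else 1) else 0) +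
      (if w = u then
        f w * (if w.1 ⟨i + 1, hi⟩ ≤ w.1 ⟨i, by omega⟩ then 0 else q - 1) else 0) := fun w => by
    simp only [heckeT, Matrix.of_apply, Word.eq_swap_iff w u, @eq_comm _ u w]
    split_ifs <;> ring
  rw [Matrix.vecMul, dotProduct, sum_congr rfl fun w _ => h w, sum_add_distrib, sum_ite_eq' univ,
    sum_ite_eq' univ]
  simp [Word.swap_apply_left, Word.swap_apply_right]

/-- The factor of the product formula that accounts for the inversions ending in a position with
letter `b`, where `c` is the content of the letters before it. -/
noncomputable def invFactor (q : ℝ) (c : Fin ℓ → ℕ) (b : Fin ℓ) : ℝ := (q ^ ∑ j ∈ Ioi b, c j)⁻¹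

lemma invFactor_addLetter {q : ℝ} (c : Fin ℓ → ℕ) (b b' : Fin ℓ) :
    invFactor q (addLetter c b') b = invFactor q c b * if b < b' then q⁻¹ else 1 := by
  rw [invFactor, invFactor, sum_addLetter]
  split_ifs with h1 h2 h2 <;> simp_all [pow_succ, mul_comm]

/-- The action of one Hecke generator on two adjacent positions with letters `b` and `b'`, after
all factors of the product formula for other positions have been cancelled. -/
lemma localFactor_exchange {q : ℝ} (hq : 0 < q) (a : Fin ℓ → ℝ) (m c : Fin ℓ → ℕ) (b b' : Fin ℓ)
    (h0 : potential q a m - potential q a c ≠ 0)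
    (h1 : potential q a m - potential q a (addLetter c b) ≠ 0) :
    localFactor q a m c b' * invFactor q (addLetter c b') b * (if b ≤ b' then q else 1) +
      localFactor q a m c b * invFactor q (addLetter c b) b' * (if b' ≤ b then 0 else q - 1) +
      localFactor q a m c b * localFactor q a m (addLetter c b) b' =
      invFactor q c b * localFactor q a m (addLetter c b) b' := by
  have hl : ∀ c b, localFactor q a m c b =
      invFactor q c b * (increment q a c b / (potential q a m - potential q a c)) := fun _ _ => rfl
  have hA : potential q a m - potential q a (addLetter c b) =
      potential q a m - potential q a c - increment q a c b := by rw [increment]; ring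
  rw [hA] at h1
  simp only [hl, invFactor_addLetter, hA]
  rcases lt_trichotomy b b' with h | rfl | h
  · have h2 : increment q a (addLetter c b) b' =
        increment q a c b' + (q - 1) * increment q a c b := by
      linear_combination increment_add_increment q a c b b' + increment_addLetter q a c h.le
    simp only [h, h.le, h.not_gt, h.not_ge, if_true, if_false, h2]
    field_simp
    ring
  · simp only [lt_irrefl, le_rfl, if_true, if_false, increment_addLetter q a c le_rfl]
    field_simp
    ring
  · simp only [h, h.le, h.not_gt, h.not_ge, if_true, if_false, increment_addLetter q a c h.le]
    field_simp
    ring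

/-! ### The eigenvector equation -/

/-- The product formula without its normalizing constant. -/
noncomputable def weight (q : ℝ) (a : Fin ℓ → ℝ) (w : Word n m) : ℝ :=
  ∏ k : Fin n, localFactor q a m (content w.1 k) (w.1 k)

/-- The product formula in which position `p` contributes only its inversions. -/
noncomputable def weightWithout (q : ℝ) (a : Fin ℓ → ℝ) (p : Fin n) (w : Word n m) : ℝ :=
  (∏ k ∈ univ.erase p, localFactor q a m (content w.1 k) (w.1 k)) *
    invFactor q (content w.1 p) (w.1 p)

lemma vecMul_weightWithout_heckeT {q : ℝ} (hq : 1 ≤ q) {a : Fin ℓ → ℝ} (ha : ∀ j, 0 < a j)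
    (i : ℕ) (hi : i + 1 < n) :
    Matrix.vecMul (weightWithout q a ⟨i + 1, hi⟩ : Word n m → ℝ) (heckeT q i hi) + weight q a =
      weightWithout q a ⟨i, by omega⟩ := by
  funext u
  set v := u.swap i hi with hv
  let p : Fin n := ⟨i, by omega⟩
  let p' : Fin n := ⟨i + 1, hi⟩
  have hpp : p ≠ p' := by simp [p, p']
  set F : Word n m → Fin n → ℝ := fun w k => localFactor q a m (content w.1 k) (w.1 k) with hF
  set R : ℝ := ∏ k ∈ (univ.erase p).erase p', F u k with hR
  have hRv : ∏ k ∈ (univ.erase p).erase p', F v k = R := by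
    refine prod_congr rfl fun k hk => ?_
    simp only [mem_erase, Ne, Fin.ext_iff, p, p'] at hk
    simp only [hF, hv, content_swap u hi hk.1, Word.swap_apply_of_ne u hi hk.2.1 hk.1]
  have e1 : ∀ w, ∏ k ∈ univ.erase p, F w k = (∏ k ∈ (univ.erase p).erase p', F w k) * F w p' :=
    fun w => (prod_erase_mul _ _ (by simp [hpp.symm])).symm
  have e2 : ∀ w, ∏ k ∈ univ.erase p', F w k = (∏ k ∈ (univ.erase p).erase p', F w k) * F w p :=
    fun w => by rw [erase_right_comm]; exact (prod_erase_mul _ _ (by simp [hpp])).symm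
  have e3 : ∏ k, F u k = R * F u p' * F u p := by
    rw [hR, ← e1]; exact (prod_erase_mul _ _ (mem_univ _)).symm
  have c1 : content u.1 (i + 1) = addLetter (content u.1 i) (u.1 p) := content_succ u.1 (by omega)
  have c2 : content v.1 (i + 1) = addLetter (content u.1 i) (u.1 p') := by
    rw [content_succ v.1 (by omega), content_swap u hi (by omega), Word.swap_apply_left]
  have l1 : v.1 p = u.1 p' := Word.swap_apply_left u i hi
  have l2 : v.1 p' = u.1 p := Word.swap_apply_right u i hi
  have key := localFactor_exchange (q := q) (by linarith) a m (content u.1 i) (u.1 p) (u.1 p')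
    (sub_pos.2 (potential_lt hq ha (content_lt u (by omega)))).ne'
    (sub_pos.2 (potential_lt hq ha (c1 ▸ content_lt u hi))).ne'
  have hvp : F v p = localFactor q a m (content u.1 i) (u.1 p') := by
    simp only [hF, l1]; rw [content_swap u hi (by simp [p])]
  have hup : F u p = localFactor q a m (content u.1 i) (u.1 p) := rfl
  have hup' : F u p' = localFactor q a m (addLetter (content u.1 i) (u.1 p)) (u.1 p') := by
    rw [← c1]
  rw [Pi.add_apply, vecMul_heckeT]
  change (∏ k ∈ univ.erase p', F v k) * invFactor q (content v.1 (i + 1)) (v.1 p') * _ +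
    (∏ k ∈ univ.erase p', F u k) * invFactor q (content u.1 (i + 1)) (u.1 p') * _ +
    ∏ k, F u k = (∏ k ∈ univ.erase p, F u k) * invFactor q (content u.1 i) (u.1 p)
  rw [e1, e2, e2, e3, hRv, hvp, hup, hup', c1, c2, l2]
  linear_combination R * key

/-- The partial sums of the random-to-top operator telescope along the left action on the product
formula. -/
lemma sum_vecMul_toFront {q : ℝ} (hq : 1 ≤ q) {a : Fin ℓ → ℝ} (ha : ∀ j, 0 < a j) (j : ℕ)
    (hj : j < n) :
    ∑ i : Fin j, Matrix.vecMul (weight q a : Word n m → ℝ) (toFront q i.1 (by omega)) +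
      Matrix.vecMul (weightWithout q a ⟨j, hj⟩ : Word n m → ℝ) (toFront q j hj) =
      weightWithout q a ⟨0, by omega⟩ := by
  induction j with
  | zero => simp [toFront]
  | succ j ih =>
    rw [← ih (by omega), ← vecMul_weightWithout_heckeT hq ha j hj, Fin.sum_univ_castSucc, toFront,
      Matrix.add_vecMul, Matrix.vecMul_vecMul]
    simp only [Fin.val_castSucc, Fin.val_last]
    abel

lemma weightWithout_last {q : ℝ} (hq : 1 ≤ q) {a : Fin ℓ → ℝ} (ha : ∀ j, 0 < a j) {k : ℕ}
    (hk : k + 1 = n) :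
    (weightWithout q a ⟨k, by omega⟩ : Word n m → ℝ) = weight q a := by
  funext w
  rw [weight, weightWithout, ← prod_erase_mul univ _ (mem_univ (⟨k, by omega⟩ : Fin n))]
  congr 1
  have h : k < n := by omega
  rw [localFactor, increment, ← content_succ w.1 h, hk, content_self, div_self, mul_one]
  · rfl
  · exact (sub_pos.2 (potential_lt hq ha (content_lt w h))).ne'

lemma vecMul_sum_toFront {q : ℝ} (hq : 1 ≤ q) {a : Fin ℓ → ℝ} (ha : ∀ j, 0 < a j)
    (hn : 0 < n) :
    Matrix.vecMul (weight q a : Word n m → ℝ) (∑ i : Fin n, toFront q i.1 i.2) =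
      weightWithout q a ⟨0, hn⟩ := by
  obtain ⟨k, rfl⟩ : ∃ k, n = k + 1 := ⟨n - 1, by omega⟩
  have h := sum_vecMul_toFront (m := m) hq ha k (Nat.lt_succ_self k)
  rw [weightWithout_last hq ha rfl] at h
  rw [← h, Matrix.vecMul_sum, Fin.sum_univ_castSucc]
  rfl

lemma vecMul_weight_tsetlin [NeZero n] {q : ℝ} (hq : 1 ≤ q) (hm : ∀ j, 0 < m j)
    (hn : ∑ j, m j = n) {x : Fin ℓ → ℝ} (hx : ∀ j, 0 < x j) :
    Matrix.vecMul (weight q (letterWeight q m x) : Word n m → ℝ) (tsetlin q x) =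
      (∑ j, x j) • weight q (letterWeight q m x) := by
  have hq0 : 0 < q := by linarith
  have ha := letterWeight_pos hq0 hm hx
  have hn0 : 0 < n := Nat.pos_of_ne_zero (NeZero.ne n)
  rw [tsetlin, ← Matrix.vecMul_vecMul, vecMul_sum_toFront hq ha hn0, weightX]
  funext w
  rw [Matrix.vecMul_diagonal, Pi.smul_apply, smul_eq_mul, sum_eq_potential hq0 hm hn, weight,
    weightWithout]
  change (∏ k ∈ univ.erase (0 : Fin n), _) * invFactor q (content w.1 0) (w.1 0) * _ = _
  rw [← prod_erase_mul univ _ (mem_univ (0 : Fin n))]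
  generalize ∏ k ∈ univ.erase (0 : Fin n), localFactor q _ m (content w.1 k) (w.1 k) = P
  have hK : 0 < potential q (letterWeight q m x) m := by
    rw [← potential_zero q (letterWeight q m x), ← content_zero w.1]
    exact potential_lt hq ha (content_lt w hn0)
  have h1 := (qInt_pos hq0 (hm (w.1 0))).ne'
  have h3 : q ^ n = q ^ (∑ j ∈ Iic (w.1 0), m j) * q ^ ∑ j ∈ Ioi (w.1 0), m j := by
    rw [← pow_add, sum_Iic_add_sum_Ioi, hn]
  have h4 : content w.1 (0 : Fin n) = 0 := content_zero w.1
  rw [content_zero, h4, localFactor, increment_zero, potential_zero, invFactor, h3]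
  simp only [letterWeight] at hK ⊢
  have := hK.ne'
  simp only [Pi.zero_apply, sum_const_zero, pow_zero, sub_zero]
  field_simp

/-! ### The product formula as a probability distribution -/

/-- The probability that the letter `b` follows letters of content `c` in a random word distributed
according to the product formula. -/
noncomputable def nextLetterProb (q : ℝ) (a : Fin ℓ → ℝ) (m c : Fin ℓ → ℕ) (b : Fin ℓ) : ℝ :=
  qInt q (m b - c b) * q ^ (∑ j ∈ Ioi b, (m j - c j)) * increment q a c b /
    (potential q a m - potential q a c)

lemma sum_nextLetterProb {q : ℝ} (hq : 1 ≤ q) {a : Fin ℓ → ℝ} (ha : ∀ j, 0 < a j)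
    {c m : Fin ℓ → ℕ} (h : c < m) : ∑ b, nextLetterProb q a m c b = 1 := by
  have h1 := sum_qInt_mul_increment q a c (m - c)
  rw [add_tsub_cancel_of_le h.le] at h1
  simp only [Pi.sub_apply] at h1
  simp only [nextLetterProb]
  rw [← sum_div, h1, div_self (sub_pos.2 (potential_lt hq ha h)).ne']

lemma content_cons {N : ℕ} (b : Fin ℓ) (w : Fin N → Fin ℓ) (k : ℕ) :
    content (Fin.cons b w : Fin (N + 1) → Fin ℓ) (k + 1) = addLetter (content w k) b := by
  ext j
  rw [content, Fin.card_filter_univ_succ, addLetter_apply]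
  simp only [Fin.val_zero, Fin.cons_zero, Fin.val_succ, Fin.cons_succ, Nat.add_lt_add_iff_right,
    Nat.succ_pos, true_and, @eq_comm _ b j, content]
  split_ifs <;> simp

/-- The words that complete a prefix of content `c` to a word of content `m` have total
probability one. -/
lemma sum_prod_nextLetterProb {q : ℝ} (hq : 1 ≤ q) {a : Fin ℓ → ℝ} (ha : ∀ j, 0 < a j)
    (m : Fin ℓ → ℕ) (N : ℕ) (c : Fin ℓ → ℕ) (hc : c ≤ m) (hN : ∑ j, c j + N = ∑ j, m j) :
    ∑ w : Fin N → Fin ℓ, (if c + content w N = m then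
      ∏ k : Fin N, nextLetterProb q a m (c + content w k) (w k) else 0) = 1 := by
  induction N generalizing c with
  | zero =>
    have : c = m := by
      funext j
      exact (sum_eq_sum_iff_of_le fun j _ => hc j).1 (by simpa using hN) j (mem_univ j)
    simp [this, content_zero]
  | succ N ih =>
    have hlt : c < m := lt_of_le_of_ne hc fun h => by rw [h] at hN; omega
    have hadd : ∀ (b : Fin ℓ) (w : Fin N → Fin ℓ) (k : ℕ),
        c + content (Fin.cons b w : Fin (N + 1) → Fin ℓ) (k + 1) =
          addLetter c b + content w k := fun b w k => by
      rw [content_cons]; ext j; simp only [Pi.add_apply, addLetter_apply]; ring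
    rw [← (Fin.consEquiv fun _ => Fin ℓ).sum_comp, Fintype.sum_prod_type,
      ← sum_nextLetterProb hq ha hlt]
    refine sum_congr rfl fun b _ => ?_
    simp only [Fin.consEquiv, Equiv.coe_fn_mk, hadd, Fin.prod_univ_succ, Fin.val_zero,
      content_zero, add_zero, Fin.cons_zero, Fin.val_succ, Fin.cons_succ, ← mul_ite_zero]
    rw [← mul_sum]
    rcases (hc b).lt_or_eq with hb | hb
    · rw [ih, mul_one]
      · intro j
        rw [addLetter_apply]
        split_ifs with hj
        · subst hj; exact hb
        · exact hc j
      · rw [sum_addLetter]; simp; omega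
    · -- a letter that is used up has probability zero
      simp [nextLetterProb, hb, qInt_zero]

/-- The number of letters `w_k` not yet used before position `k` runs, for each letter `j`, through
`m_j, …, 1`; the product telescopes. -/
lemma prod_qInt_sub_content (q : ℝ) (w : Word n m) (K : ℕ) (hK : K ≤ n) :
    (∏ k : Fin K, qInt q (m (w.1 ⟨k, by omega⟩) - content w.1 k (w.1 ⟨k, by omega⟩))) *
      ∏ j, qFactorial q (m j - content w.1 K j) = ∏ j, qFactorial q (m j) := by
  induction K with
  | zero => simp [content_zero]
  | succ K ih =>
    have hK' : K < n := hK
    rw [← ih (by omega), Fin.prod_univ_castSucc, mul_assoc]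
    simp only [Fin.val_castSucc, Fin.val_last]
    congr 1
    set b := w.1 ⟨K, hK'⟩ with hb
    have hle : addLetter (content w.1 K) b b ≤ m b := by
      rw [hb, ← content_succ w.1 hK', ← w.2 (w.1 ⟨K, hK'⟩)]
      exact card_le_card fun i => by simp
    rw [addLetter_apply, if_pos rfl] at hle
    rw [content_succ w.1 hK', ← hb, ← mul_prod_erase univ _ (mem_univ b),
      ← mul_prod_erase univ (fun j => qFactorial q (m j - content w.1 K j)) (mem_univ b),
      ← mul_assoc]
    congr 1
    · obtain ⟨t, ht⟩ : ∃ t, m b = content w.1 K b + 1 + t := ⟨_, (Nat.add_sub_cancel' hle).symm⟩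
      have e1 : m b - content w.1 K b = t + 1 := by omega
      have e2 : m b - addLetter (content w.1 K) b b = t := by
        rw [addLetter_apply, if_pos rfl]; omega
      rw [e1, e2, qFactorial, qFactorial, prod_range_succ, mul_comm]
    · refine prod_congr rfl fun j hj => ?_
      rw [addLetter_apply, if_neg (ne_of_mem_erase hj), add_zero]

/-- The product formula is the law of a random word whose letters are chosen one after the other
with the probabilities `nextLetterProb`. -/
lemma normalization_mul_weight {q : ℝ} (hq : 1 ≤ q) (hn : ∑ j, m j = n) (a : Fin ℓ → ℝ)
    (w : Word n m) :
    normalization q n m * weight q a w =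
      ∏ k : Fin n, nextLetterProb q a m (content w.1 k) (w.1 k) := by
  have hq0 : 0 < q := by linarith
  have h1 : ∀ k : Fin n, nextLetterProb q a m (content w.1 k) (w.1 k) =
      localFactor q a m (content w.1 k) (w.1 k) *
        (qInt q (m (w.1 k) - content w.1 k (w.1 k)) * q ^ ∑ j ∈ Ioi (w.1 k), m j) := fun k => by
    have e : ∑ j ∈ Ioi (w.1 k), m j = ∑ j ∈ Ioi (w.1 k), (m j - content w.1 k j) +
        ∑ j ∈ Ioi (w.1 k), content w.1 k j := by
      rw [← sum_add_distrib]
      exact sum_congr rfl fun j _ => (Nat.sub_add_cancel ((content_lt w k.2).le j)).symm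
    rw [nextLetterProb, localFactor, e, pow_add]
    field_simp
  have h2 : ∏ k : Fin n, qInt q (m (w.1 k) - content w.1 k (w.1 k)) = ∏ j, qFactorial q (m j) := by
    have := prod_qInt_sub_content q w n le_rfl
    simpa [content_self, qFactorial] using this
  have h3 : ∏ k : Fin n, q ^ (∑ j ∈ Ioi (w.1 k), m j) = q ^ ∑ b, m b * ∑ j ∈ Ioi b, m j := by
    rw [prod_pow_eq_pow_sum, ← sum_fiberwise' univ w.1 fun b => ∑ j ∈ Ioi b, m j]
    congr 1
    refine sum_congr rfl fun b _ => ?_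
    rw [sum_const, w.2 b, smul_eq_mul]
  have h4 : n.choose 2 = ∑ b, m b * (∑ j ∈ Ioi b, m j) + ∑ b, (m b).choose 2 := by
    rw [← hn, ← sum_mul_sum_add_sum_choose_two]
    congr 1
    refine sum_congr rfl fun b _ => ?_
    congr 2; ext; simp
  simp only [h1, prod_mul_distrib, h2, h3]
  rw [normalization, h4, pow_add, prod_mul_distrib, prod_inv_distrib, prod_pow_eq_pow_sum, weight]
  field_simp

lemma sum_normalization_mul_weight {q : ℝ} (hq : 1 ≤ q) (hn : ∑ j, m j = n) {a : Fin ℓ → ℝ}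
    (ha : ∀ j, 0 < a j) : ∑ w : Word n m, normalization q n m * weight q a w = 1 := by
  have h := sum_prod_nextLetterProb hq ha m n 0 (fun j => Nat.zero_le _) (by simp [hn])
  rw [← sum_filter] at h
  rw [← h]
  simp only [normalization_mul_weight hq hn, zero_add]
  refine (sum_subtype _ (p := fun w : Fin n → Fin ℓ => ∀ j, #{i | w i = j} = m j) (fun w => ?_)
    fun w => ∏ k : Fin n, nextLetterProb q a m (content w k) (w k)).symm
  simp [funext_iff, content]

/-! ### Uniqueness of the eigenvector -/

/-- Perron's argument: a nonnegative irreducible matrix with a positive left eigenvector has no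
other left eigenvectors for the same eigenvalue. Irreducibility is stated for sets of indices
closed under predecessors. -/
lemma eq_smul_of_vecMul_eq_smul {ι : Type*} [Fintype ι] [Nonempty ι] {A : Matrix ι ι ℝ}
    (hA : ∀ v w, 0 ≤ A v w)
    (hirr : ∀ Z : Set ι, Z.Nonempty → (∀ v w, w ∈ Z → 0 < A v w → v ∈ Z) → Z = Set.univ)
    {ψ φ : ι → ℝ} {r : ℝ} (hψ : ∀ w, 0 < ψ w) (hψA : Matrix.vecMul ψ A = r • ψ)
    (hφA : Matrix.vecMul φ A = r • φ) : ∃ t : ℝ, φ = t • ψ := by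
  obtain ⟨w₀, hw₀⟩ := Finite.exists_max fun w => φ w / ψ w
  set t := φ w₀ / ψ w₀ with ht
  have hle : ∀ v, 0 ≤ t * ψ v - φ v := fun v => by
    have := (div_le_iff₀ (hψ v)).1 (hw₀ v)
    linarith
  refine ⟨t, ?_⟩
  have hZ := hirr {w | φ w = t * ψ w} ⟨w₀, (div_mul_cancel₀ _ (hψ w₀).ne').symm⟩ ?_
  · funext w
    have : w ∈ {w | φ w = t * ψ w} := hZ ▸ Set.mem_univ w
    exact this
  · intro v w hw hvw
    have h1 : ∑ u, (t * ψ u - φ u) * A u w = 0 := by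
      have e1 : ∑ u, ψ u * A u w = r * ψ w := congrFun hψA w
      have e2 : ∑ u, φ u * A u w = r * φ w := congrFun hφA w
      simp only [sub_mul, sum_sub_distrib, mul_assoc, ← mul_sum]
      rw [e1, e2, show φ w = t * ψ w from hw]
      ring
    have h2 := (sum_eq_zero_iff_of_nonneg fun u _ => mul_nonneg (hle u) (hA u w)).1 h1 v
      (mem_univ v)
    have h3 := (mul_eq_zero.1 h2).resolve_right hvw.ne'
    exact (sub_eq_zero.1 h3).symm

/-- The word obtained from `w` by moving the letter in position `i` to the front. -/
def Word.bringFront (w : Word n m) : (i : ℕ) → i < n → Word n m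
  | 0, _ => w
  | i + 1, h => (w.swap i h).bringFront i (by omega)

lemma Word.swap_injective (i : ℕ) (hi : i + 1 < n) :
    Function.Injective fun w : Word n m => w.swap i hi := fun w v h => by
  rw [← w.swap_swap i hi, ← v.swap_swap i hi]
  exact congrArg (fun u : Word n m => u.swap i hi) h

lemma Word.bringFront_injective (i : ℕ) (hi : i < n) :
    Function.Injective fun w : Word n m => w.bringFront i hi := by
  induction i with
  | zero => exact fun _ _ h => h
  | succ i ih => exact (ih (by omega)).comp (Word.swap_injective i hi)

lemma heckeT_nonneg {q : ℝ} (hq : 1 ≤ q) (i : ℕ) (hi : i + 1 < n) (w v : Word n m) :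
    0 ≤ heckeT q i hi w v := by
  simp only [heckeT, Matrix.of_apply]
  split_ifs <;> linarith

lemma heckeT_swap_pos {q : ℝ} (hq : 1 ≤ q) (i : ℕ) (hi : i + 1 < n) (w : Word n m) :
    0 < heckeT q i hi w (w.swap i hi) := by
  simp only [heckeT, Matrix.of_apply, if_true]
  split_ifs <;> linarith

lemma toFront_nonneg {q : ℝ} (hq : 1 ≤ q) (i : ℕ) (hi : i < n) (w v : Word n m) :
    0 ≤ toFront q i hi w v := by
  induction i generalizing w with
  | zero => rw [toFront, Matrix.one_apply]; split_ifs <;> simp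
  | succ i ih =>
    rw [toFront, Matrix.mul_apply]
    exact sum_nonneg fun u _ => mul_nonneg (heckeT_nonneg hq i hi w u) (ih _ u)

lemma toFront_bringFront_pos {q : ℝ} (hq : 1 ≤ q) (i : ℕ) (hi : i < n) (w : Word n m) :
    0 < toFront q i hi w (w.bringFront i hi) := by
  induction i generalizing w with
  | zero => rw [toFront, Word.bringFront, Matrix.one_apply_eq]; exact one_pos
  | succ i ih =>
    rw [toFront, Matrix.mul_apply, Word.bringFront]
    exact sum_pos' (fun u _ => mul_nonneg (heckeT_nonneg hq i hi w u) (toFront_nonneg hq i _ u _))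
      ⟨_, mem_univ _, mul_pos (heckeT_swap_pos hq i hi w) (ih (by omega) _)⟩

lemma tsetlin_apply [NeZero n] (q : ℝ) (x : Fin ℓ → ℝ) (v w : Word n m) :
    tsetlin q x v w = (∑ i : Fin n, toFront q i.1 i.2 v w) *
      (x (w.1 0) / (q ^ (∑ j ∈ Ioi (w.1 0), m j) * qInt q (m (w.1 0)))) := by
  rw [tsetlin, weightX, Matrix.mul_diagonal, Matrix.sum_apply]

lemma weightX_pos [NeZero n] {q : ℝ} (hq : 0 < q) (hm : ∀ j, 0 < m j) {x : Fin ℓ → ℝ}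
    (hx : ∀ j, 0 < x j) (w : Word n m) :
    0 < x (w.1 0) / (q ^ (∑ j ∈ Ioi (w.1 0), m j) * qInt q (m (w.1 0))) := by
  have := hx (w.1 0)
  have := qInt_pos hq (hm (w.1 0))
  positivity

lemma tsetlin_nonneg [NeZero n] {q : ℝ} (hq : 1 ≤ q) (hm : ∀ j, 0 < m j) {x : Fin ℓ → ℝ}
    (hx : ∀ j, 0 < x j) (v w : Word n m) : 0 ≤ tsetlin q x v w := by
  rw [tsetlin_apply]
  exact mul_nonneg (sum_nonneg fun i _ => toFront_nonneg hq _ _ _ _)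
    (weightX_pos (by linarith) hm hx w).le

lemma tsetlin_bringFront_pos [NeZero n] {q : ℝ} (hq : 1 ≤ q) (hm : ∀ j, 0 < m j) {x : Fin ℓ → ℝ}
    (hx : ∀ j, 0 < x j) (i : ℕ) (hi : i < n) (w : Word n m) :
    0 < tsetlin q x w (w.bringFront i hi) := by
  rw [tsetlin_apply]
  exact mul_pos (sum_pos' (fun i _ => toFront_nonneg hq _ _ _ _)
    ⟨⟨i, hi⟩, mem_univ _, toFront_bringFront_pos hq i hi w⟩) (weightX_pos (by linarith) hm hx _)

/-- Any two words of the same content are connected by exchanges of adjacent letters. -/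
lemma eq_univ_of_swap_mem {Z : Set (Word n m)} (hZ : Z.Nonempty)
    (h : ∀ (w : Word n m) (i : ℕ) (hi : i + 1 < n), w ∈ Z → w.swap i hi ∈ Z) : Z = Set.univ := by
  obtain ⟨w, hw⟩ := hZ
  refine Set.eq_univ_of_forall fun v => ?_
  have hcard : ∀ j, Fintype.card {i // v.1 i = j} = Fintype.card {i // w.1 i = j} := fun j => by
    rw [Fintype.card_subtype, Fintype.card_subtype, v.2 j, w.2 j]
  set σ : Equiv.Perm (Fin n) := Equiv.ofFiberEquiv fun j => Fintype.equivOfCardEq (hcard j) with hσ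
  have hv : v.1 = w.1 ∘ σ := by
    funext i; exact (Equiv.ofFiberEquiv_map _ i).symm
  clear_value σ
  rcases n with - | n
  · have : v = w := Subtype.ext (funext fun i => i.elim0)
    exact this ▸ hw
  have hmem : σ ∈ Submonoid.closure
      (Set.range fun i : Fin n => Equiv.swap i.castSucc i.succ) := by
    rw [Equiv.Perm.mclosure_swap_castSucc_succ]; trivial
  clear hσ hcard
  induction hmem using Submonoid.closure_induction generalizing w v with
  | mem σ hσ =>
    obtain ⟨i, rfl⟩ := hσ
    have : v = w.swap i.1 (by omega) := Subtype.ext hv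
    exact this ▸ h w _ _ hw
  | one =>
    have : v = w := Subtype.ext hv
    exact this ▸ hw
  | mul σ τ _ _ h1 h2 =>
    let u : Word (n + 1) m := ⟨w.1 ∘ σ, fun j => by
      rw [← w.2 j]; exact card_equiv σ (by simp)⟩
    exact h2 u (h1 w hw u rfl) v (by rw [hv]; rfl)

/-- Irreducibility of the `q`-Tsetlin library. A set of words closed under predecessors is mapped
onto itself by each of the bijections `bringFront`, hence also by the adjacent exchanges, which are
their successive quotients. -/
lemma eq_univ_of_tsetlin_pos [NeZero n] {q : ℝ} (hq : 1 ≤ q) (hm : ∀ j, 0 < m j) {x : Fin ℓ → ℝ}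
    (hx : ∀ j, 0 < x j) (Z : Set (Word n m)) (hZ : Z.Nonempty)
    (h : ∀ v w : Word n m, w ∈ Z → 0 < tsetlin q x v w → v ∈ Z) : Z = Set.univ := by
  have hfront : ∀ (i : ℕ) (hi : i < n) (w : Word n m), w.bringFront i hi ∈ Z ↔ w ∈ Z := by
    intro i hi w
    refine ⟨fun hw => h _ _ hw (tsetlin_bringFront_pos hq hm hx i hi w), fun hw => ?_⟩
    set f : Word n m → Word n m := fun w => w.bringFront i hi with hf
    have hinj : Function.Injective f := Word.bringFront_injective i hi
    -- the preimage of `Z` is contained in `Z` and equally large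
    have hsub : f ⁻¹' Z ⊆ Z := fun v hv => h _ _ hv (tsetlin_bringFront_pos hq hm hx i hi v)
    have heq : f ⁻¹' Z = Z := Set.eq_of_subset_of_ncard_le hsub
      (Set.ncard_preimage_of_injective_subset_range hinj
        (by rw [(Finite.injective_iff_surjective.1 hinj).range_eq]; exact Set.subset_univ _)).ge
      (Set.toFinite _)
    rw [← heq] at hw
    exact hw
  refine eq_univ_of_swap_mem hZ fun w i hi hw => ?_
  rw [← hfront i (by omega), show (w.swap i hi).bringFront i _ = w.bringFront (i + 1) hi from rfl,
    hfront]
  exact hw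

lemma normalization_pos {q : ℝ} (hq : 0 < q) (n : ℕ) (m : Fin ℓ → ℕ) : 0 < normalization q n m :=
  mul_pos (prod_pos fun j _ => mul_pos (by positivity) (qFactorial_pos hq _)) (by positivity)

lemma weight_pos {q : ℝ} (hq : 1 ≤ q) {a : Fin ℓ → ℝ} (ha : ∀ j, 0 < a j) (w : Word n m) :
    0 < weight q a w := by
  have hq0 : 0 < q := by linarith
  refine prod_pos fun k _ => mul_pos (by positivity) (div_pos (increment_pos hq ha _ _) ?_)
  exact sub_pos.2 (potential_lt hq ha (content_lt w k.2))

end QTsetlin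

open QTsetlin in
theorem mainTheorem5 {ℓ n : ℕ} [NeZero n] (m : Fin ℓ → ℕ) (hm : ∀ j, 0 < m j)
    (hn : ∑ j, m j = n) (q : ℝ) (hq : 1 ≤ q) (x : Fin ℓ → ℝ) (hx : ∀ j, 0 < x j) :
    -- the product formula is an eigenvector, and the eigenvector is unique up to scaling
    (Matrix.vecMul (Psi q x : Word n m → ℝ) (tsetlin q x) =
        (∑ j, x j) • (Psi q x : Word n m → ℝ) ∧
      ∀ Φ : Word n m → ℝ, Matrix.vecMul Φ (tsetlin q x) = (∑ j, x j) • Φ →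
        Φ = (∑ w, Φ w) • (Psi q x : Word n m → ℝ)) ∧
    -- each factor of the product formula is positive
    (∀ w : Word n m,
      0 < (q ^ inv w)⁻¹ ∧
      (∀ j, 0 < (q ^ (m j).choose 2)⁻¹ ∧ 0 < qFactorial q (m j)) ∧
      ∀ k : Fin n, k.1 + 1 < n →
        0 < denFactor q x w k ∧
        (IsLRM w k → 0 < lrmFactor q x w k) ∧
        (¬ IsLRM w k → 0 < nonLrmFactor q x w k)) ∧
    -- the entries sum to one
    ∑ w : Word n m, Psi q x w = 1 := by
  have hq0 : 0 < q := by linarith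
  have ha := letterWeight_pos hq0 hm hx
  have hPsi : (Psi q x : Word n m → ℝ) =
      normalization q n m • weight q (letterWeight q m x) :=
    funext fun w => Psi_eq hq hm hn hx w
  have hsum : ∑ w : Word n m, Psi q x w = 1 := by
    rw [hPsi]; exact sum_normalization_mul_weight hq hn ha
  have heig : Matrix.vecMul (Psi q x : Word n m → ℝ) (tsetlin q x) =
      (∑ j, x j) • (Psi q x : Word n m → ℝ) := by
    rw [hPsi, Matrix.smul_vecMul, vecMul_weight_tsetlin hq hm hn hx, smul_comm]
  refine ⟨⟨heig, fun Φ hΦ => ?_⟩, fun w => ⟨by positivity, fun j =>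
    ⟨by positivity, qFactorial_pos hq0 _⟩, fun k _ => ⟨?_, fun hk => ?_, fun _ => ?_⟩⟩, hsum⟩
  · have : Nonempty (Word n m) := by
      by_contra h
      rw [not_nonempty_iff] at h
      simp at hsum
    have hpos : ∀ w : Word n m, 0 < Psi q x w := fun w => by
      rw [hPsi]; exact mul_pos (normalization_pos hq0 n m) (weight_pos hq ha w)
    obtain ⟨t, rfl⟩ := eq_smul_of_vecMul_eq_smul (tsetlin_nonneg hq hm hx)
      (eq_univ_of_tsetlin_pos hq hm hx) hpos heig hΦ
    simp only [Pi.smul_apply, smul_eq_mul]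
    rw [← mul_sum, hsum, mul_one]
  · rw [denFactor_eq hq0 hm hn]
    exact mul_pos (by positivity) (sub_pos.2 (potential_lt hq ha (content_lt w k.2)))
  · rw [lrmFactor_eq hq0 x w k hk]
    exact mul_pos (by positivity) (increment_pos hq ha _ _)
  · rw [nonLrmFactor_eq hq0 x w k]
    exact mul_pos (by positivity) (increment_pos hq ha _ _)
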